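/- Let $\Theta(t)=\log\frac{t/2}{\sinh(t/2)}\in\mathbb{Q}[[t]]$, and let the polynomials $A_k(x,\nu)\in\mathbb{Q}[x,\nu]$, $k\ge 0$, be defined by $$e^{xt}\exp\bigl(\nu\,\Theta(t)\bigr)=\sum_{k=0}^{\infty}A_k(x,\nu)\frac{t^k}{k!}.$$ Fix $\nu\in\mathbb{R}\setminus\mathbb{Z}_{\le 0}$ and a compact interval $I\subset\mathbb{R}$. Then, as $k\to\infty$, the functions $$(-1)^kA_{2k}(x,\nu)\,\frac{(2\pi)^{2k}\,\Gamma(\nu)}{2\,(2k)!\,(2k)^{\nu-1}}$$ converge to $\cos(2\pi x)$ uniformly on $I$, and the functions $$(-1)^{k-1}A_{2k-1}(x,\nu)\,\frac{(2\pi)^{2k-1}\,\Gamma(\nu)}{2\,(2k-1)!\,(2k-1)^{\nu-1}}$$ converge to $\sin(2\pi x)$ uniformly on $I$. More precisely, there is a constant $C>0$, depending only on $\nu$ and $I$, such that for all integers $k\ge 1$ and all $x\in I$ $$\left|A_k(x,\nu)\,\frac{(2\pi)^{k}\,\Gamma(\nu)}{2\,k!\,k^{\nu-1}}-\cos\Bigl(2\pi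 x-\frac{\pi}{2}k\Bigr)\right|<C\,k^{-7/9}.$$ -/

import Mathlib

open Filter

noncomputable section

namespace GenBernoulli

/-- The formal power series of `sinh (t / 2) = (exp (t / 2) - exp (-t / 2)) / 2`. -/
def sinhHalf : PowerSeries ℚ :=
  PowerSeries.C (1 / 2 : ℚ) *
    (PowerSeries.rescale (1 / 2 : ℚ) (PowerSeries.exp ℚ) -
      PowerSeries.rescale (-1 / 2 : ℚ) (PowerSeries.exp ℚ))

/-- The formal power series of `sinh (t / 2) / (t / 2)`; see `half_X_mul_sinhQuot`. -/
def sinhQuot : PowerSeries ℚ :=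
  PowerSeries.mk fun n => 2 * PowerSeries.coeff (n + 1) sinhHalf

theorem half_X_mul_sinhQuot :
    (PowerSeries.C (1 / 2 : ℚ) * PowerSeries.X) * sinhQuot = sinhHalf := by
  ext n
  rw [mul_assoc, PowerSeries.coeff_C_mul]
  cases n with
  | zero =>
    have h (c : ℚ) :
        PowerSeries.constantCoeff (PowerSeries.rescale c (PowerSeries.exp ℚ)) = 1 := by
      rw [← PowerSeries.coeff_zero_eq_constantCoeff_apply, PowerSeries.coeff_rescale]
      simp
    simp [sinhHalf, h]
  | succ n => rw [PowerSeries.coeff_succ_X_mul]; simp [sinhQuot]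

theorem constantCoeff_sinhQuot : PowerSeries.constantCoeff sinhQuot = 1 := by
  rw [← PowerSeries.coeff_zero_eq_constantCoeff_apply]
  simp [sinhQuot, sinhHalf, PowerSeries.coeff_exp, PowerSeries.coeff_rescale]
  norm_num

/-- The formal power series `Θ(t) = log ((t / 2) / sinh (t / 2))`. Since the constant coefficient
of `sinhQuot` is `1`, the inverse and the formal logarithm are the genuine ones. -/
def theta : PowerSeries ℚ :=
  PowerSeries.logOf sinhQuot⁻¹

theorem constantCoeff_theta : PowerSeries.constantCoeff theta = 0 :=
  PowerSeries.constantCoeff_logOf (by simp [constantCoeff_sinhQuot])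

/-- The generating series `exp (x t) * exp (ν * Θ(t))`, as a formal power series in `t` over a
commutative `ℚ`-algebra containing `x` and `ν`. -/
def genSeries (R : Type*) [CommRing R] [Algebra ℚ R] (x ν : R) : PowerSeries R :=
  PowerSeries.rescale x (PowerSeries.exp R) *
    (PowerSeries.exp R).subst (PowerSeries.C ν * PowerSeries.map (algebraMap ℚ R) theta)

/-- The substitution in `genSeries` is a legitimate one. -/
theorem hasSubst_theta (R : Type*) [CommRing R] [Algebra ℚ R] (ν : R) :
    PowerSeries.HasSubst (PowerSeries.C ν * PowerSeries.map (algebraMap ℚ R) theta) := by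
  apply PowerSeries.HasSubst.of_constantCoeff_zero'
  have h : PowerSeries.constantCoeff (PowerSeries.map (algebraMap ℚ R) theta) = 0 := by
    rw [← PowerSeries.coeff_zero_eq_constantCoeff_apply, PowerSeries.coeff_map,
      PowerSeries.coeff_zero_eq_constantCoeff_apply, constantCoeff_theta, map_zero]
  rw [map_mul, h, mul_zero]

/-- The polynomial `A_k ∈ ℚ[x, ν]`, where `x` is the variable `0` and `ν` is the variable `1`:
`exp (x t) * exp (ν * Θ(t)) = ∑ k, A_k(x, ν) * t ^ k / k!`. -/
def polyA (k : ℕ) : MvPolynomial (Fin 2) ℚ :=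
  (k.factorial : MvPolynomial (Fin 2) ℚ) *
    PowerSeries.coeff k
      (genSeries (MvPolynomial (Fin 2) ℚ) (MvPolynomial.X 0) (MvPolynomial.X 1))

/-- The real value `A_k(x, ν)`. -/
def A (k : ℕ) (x ν : ℝ) : ℝ :=
  MvPolynomial.aeval ![x, ν] (polyA k)

end GenBernoulli

end

/-!
Substitute `t = 2 π u` in `exp (x t) * exp (ν Θ(t))`. The singularities closest to `0` are
`u = ± i`, and near them the series behaves like a constant times `(1 + u ^ 2) ^ (-ν)`. Write it as
the product of this singular factor and a regular factor `G`.

* The coefficients of the singular factor are, up to sign, the binomial coefficients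
  `ν (ν + 1) ⋯ (ν + j - 1) / j!` in the even degrees `2 j`. Multiplied by `Γ(ν) j ^ (1 - ν)` they
  are `1 + O(1 / j)`: they converge by Euler's limit formula for `Γ`, and consecutive terms differ
  by `O(1 / j ^ 2)` (`exists_negBinomCoeff_bound`).
* The logarithmic derivative of `G` is explicit. The coefficients of `t Θ'(t)` are Bernoulli
  numbers, hence values `ζ(2 j)`; dividing out the singular factor replaces `ζ(2 j)` by
  `ζ(2 j) - 1`, which is `O(4 ^ (-j))`. So `G' = (2 π x + ν * regularPart) G`, where the
  coefficients of `regularPart` decay geometrically (`derivative_regularFactor`). It follows that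
  the coefficients of `G` decay geometrically, uniformly for `x` in a compact set, and that `G(i)`
  is the exponential of the integrated series. Since `∑ (ζ(2 j) - 1) / j = log 2`, this gives
  `G(i) = 2 ^ ν * exp (2 π i x)` (`exists_regularFactor_bound`).

The `k`-th coefficient of the product is the convolution of the two sequences. After
normalization, the coefficient of degree `k - m` of the singular factor is `cos (π (k - m) / 2)`
up to `O((1 + m) ^ B / k)` (`exists_normalized_singCoeff_bound`), and the geometric decay of `G`
absorbs the powers of `1 + m`. So the main term is `2 ^ (-ν) ∑ m, G_m cos (π (k - m) / 2)`, where
the sum is the real part of `G(i) exp (-i π k / 2)`, and the error is `O(1 / k)`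
(`exists_A_bound`). This is stronger than the exponent `7 / 9`, and both uniform limits are the
estimate along even and odd indices.
-/

open scoped PowerSeries

namespace GenBernoulli

/-! ### The generating series -/

section

open PowerSeries

theorem derivative_logOf_mul {R : Type*} [CommRing R] [Algebra ℚ R] {f : R⟦X⟧}
    (hf : constantCoeff f = 1) : d⁄dX R (logOf f) * f = d⁄dX R f := by
  have hs : HasSubst (f - 1) := HasSubst.of_constantCoeff_zero' (by simp [hf])
  have hgeom : d⁄dX R (log R) * (1 + X) = 1 := by
    rw [deriv_log]
    ext n
    cases n with
    | zero => simp [mul_add]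
    | succ n => simp [mul_add, coeff_succ_mul_X, pow_succ, coeff_one]
  have h := congrArg (subst (f - 1)) hgeom
  rw [subst_mul hs, subst_add hs, subst_X hs] at h
  have h1 : subst (f - 1) (1 : R⟦X⟧) = 1 := by
    rw [← coe_substAlgHom hs, map_one]
  rw [h1, add_sub_cancel] at h
  rw [logOf_eq, derivative_subst hs, map_sub, derivative_one, sub_zero]
  linear_combination (d⁄dX R f) * h

theorem derivative_theta_mul_sinhQuot :
    d⁄dX ℚ theta * sinhQuot = -d⁄dX ℚ sinhQuot := by
  have hne : constantCoeff sinhQuot ≠ 0 := by rw [constantCoeff_sinhQuot]; exact one_ne_zero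
  have hinv : sinhQuot * sinhQuot⁻¹ = 1 := PowerSeries.mul_inv_cancel _ hne
  have h := derivative_logOf_mul (f := sinhQuot⁻¹) (by simp [constantCoeff_sinhQuot])
  rw [derivative_inv'] at h
  change d⁄dX ℚ theta * sinhQuot⁻¹ = _ at h
  linear_combination sinhQuot ^ 2 * h -
    (d⁄dX ℚ theta * sinhQuot + d⁄dX ℚ sinhQuot * (sinhQuot * sinhQuot⁻¹ + 1)) * hinv

theorem derivative_rescale_exp {R : Type*} [CommRing R] [Algebra ℚ R] (c : R) :
    d⁄dX R (rescale c (exp R)) = C c * rescale c (exp R) := by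
  ext n
  have h := congrArg (coeff n) (derivative_exp R)
  rw [coeff_derivative] at h
  rw [coeff_derivative, coeff_rescale, coeff_C_mul, coeff_rescale, ← h]
  ring

/-- `t Θ'(t) = 1 - (t / 2) coth (t / 2)`, with the Bernoulli series `t / (exp t - 1)` in place
of the hyperbolic cotangent. -/
theorem X_mul_derivative_theta :
    X * d⁄dX ℚ theta = 1 - bernoulliPowerSeries ℚ - C (1 / 2 : ℚ) * X := by
  set e : ℚ⟦X⟧ := rescale (1 / 2 : ℚ) (exp ℚ) with he
  set e' : ℚ⟦X⟧ := rescale (-1 / 2 : ℚ) (exp ℚ) with he'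
  have hC : (C (1 / 2 : ℚ) : ℚ⟦X⟧) * 2 = 1 := by
    rw [show (2 : ℚ⟦X⟧) = C (2 : ℚ) from (map_ofNat C 2).symm, ← map_mul]; norm_num
  have hCn : (C (-1 / 2 : ℚ) : ℚ⟦X⟧) = -C (1 / 2 : ℚ) := by rw [← map_neg]; norm_num
  have hee' : e * e' = 1 := by
    rw [he, he', exp_mul_exp_eq_exp_add]; norm_num
  have hee : e * e = exp ℚ := by
    rw [he, exp_mul_exp_eq_exp_add]; norm_num
  have hB := bernoulliPowerSeries_mul_exp_sub_one ℚ
  rw [← hee] at hB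
  have hde : d⁄dX ℚ e = C (1 / 2 : ℚ) * e := derivative_rescale_exp _
  have hde' : d⁄dX ℚ e' = C (-1 / 2 : ℚ) * e' := derivative_rescale_exp _
  have hS : C (1 / 2 : ℚ) * X * sinhQuot = C (1 / 2 : ℚ) * (e - e') := half_X_mul_sinhQuot
  have hS1 : X * sinhQuot = e - e' := by
    linear_combination 2 * hS - (X * sinhQuot - (e - e')) * hC
  have hS2 : sinhQuot + X * d⁄dX ℚ sinhQuot = C (1 / 2 : ℚ) * (e + e') := by
    have h := congrArg (d⁄dX ℚ) hS1
    rw [Derivation.leibniz, map_sub, hde, hde', derivative_X, hCn] at h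
    simp only [smul_eq_mul] at h
    linear_combination h
  have hθ := derivative_theta_mul_sinhQuot
  have hne : e - e' ≠ 0 := by
    rw [← hS1]
    refine mul_ne_zero X_ne_zero fun h => ?_
    have := constantCoeff_sinhQuot
    simp [h] at this
  refine mul_right_cancel₀ hne ?_
  linear_combination -X * d⁄dX ℚ theta * hS1 + X ^ 2 * hθ - X * hS2 + hS1 + e' * hB
    - (bernoulliPowerSeries ℚ * e) * hee' - X * e' * hC

theorem coeff_derivative_theta_odd (j : ℕ) :
    coeff (2 * j + 1) (d⁄dX ℚ theta) = -(bernoulli (2 * (j + 1)) / (2 * (j + 1)).factorial) := by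
  have h := congrArg (coeff (2 * j + 1 + 1)) X_mul_derivative_theta
  rw [coeff_succ_X_mul] at h
  rw [h, show 2 * (j + 1) = 2 * j + 1 + 1 by ring]
  simp [bernoulliPowerSeries, coeff_one]

theorem coeff_derivative_theta_even (j : ℕ) : coeff (2 * j) (d⁄dX ℚ theta) = 0 := by
  have h := congrArg (coeff (2 * j + 1)) X_mul_derivative_theta
  rw [coeff_succ_X_mul] at h
  rw [h]
  rcases Nat.eq_zero_or_pos j with rfl | hj
  · simp [bernoulliPowerSeries, coeff_one]
    norm_num
  · have hb : bernoulli (2 * j + 1) = 0 := by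
      rw [bernoulli_eq_bernoulli'_of_ne_one (by omega)]
      exact bernoulli'_eq_zero_of_odd ⟨j, rfl⟩ (by omega)
    simp [bernoulliPowerSeries, coeff_one, hb, hj.ne', coeff_C]

theorem constantCoeff_genSeries {R : Type*} [CommRing R] [Algebra ℚ R] (x ν : R) :
    constantCoeff (genSeries R x ν) = 1 := by
  have h0 : constantCoeff (C ν * map (algebraMap ℚ R) theta) = 0 := by
    rw [map_mul, ← coeff_zero_eq_constantCoeff_apply (map (algebraMap ℚ R) theta), coeff_map,
      coeff_zero_eq_constantCoeff_apply, constantCoeff_theta, map_zero, mul_zero]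
  have h1 : constantCoeff ((exp R - 1).subst (C ν * map (algebraMap ℚ R) theta)) = 0 :=
    constantCoeff_subst_eq_zero h0 _ (by simp)
  have h2 : (exp R).subst (C ν * map (algebraMap ℚ R) theta) =
      (exp R - 1).subst (C ν * map (algebraMap ℚ R) theta) + 1 := by
    have hs := hasSubst_theta R ν
    rw [← coe_substAlgHom hs, map_sub, map_one, sub_add_cancel]
  rw [genSeries, h2, map_mul, map_add, h1, ← coeff_zero_eq_constantCoeff_apply, coeff_rescale]
  simp

/-- The logarithmic derivative of the generating series is `x + ν Θ'`. -/
theorem derivative_genSeries {R : Type*} [CommRing R] [Algebra ℚ R] (x ν : R) :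
    d⁄dX R (genSeries R x ν) =
      (C x + C ν * map (algebraMap ℚ R) (d⁄dX ℚ theta)) * genSeries R x ν := by
  have hmap : d⁄dX R (map (algebraMap ℚ R) theta) = map (algebraMap ℚ R) (d⁄dX ℚ theta) := by
    ext n
    simp [coeff_derivative]
  rw [genSeries, Derivation.leibniz, derivative_subst (hasSubst_theta R ν), derivative_exp,
    derivative_rescale_exp, Derivation.leibniz, hmap, derivative_C]
  simp only [smul_eq_mul]
  ring

theorem map_genSeries {R S : Type*} [CommRing R] [Algebra ℚ R] [CommRing S] [Algebra ℚ S]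
    (f : R →+* S) (x ν : R) : map f (genSeries R x ν) = genSeries S (f x) (f ν) := by
  have h1 : map f (C ν * map (algebraMap ℚ R) theta) =
      C (f ν) * map (algebraMap ℚ S) theta := by
    ext n
    simp [coeff_map, coeff_C_mul]
  have h2 : map f (rescale x (exp R)) = rescale (f x) (exp S) := by
    ext n
    simp [coeff_exp]
  rw [genSeries, genSeries, map_mul, h2, ← h1, ← map_exp f]
  congr 1
  exact map_subst (hasSubst_theta R ν) _

theorem A_eq (k : ℕ) (x ν : ℝ) : A k x ν = k.factorial * coeff k (genSeries ℝ x ν) := by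
  have h := map_genSeries (MvPolynomial.aeval ![x, ν]).toRingHom
    (MvPolynomial.X 0 : MvPolynomial (Fin 2) ℚ) (MvPolynomial.X 1)
  have h' := congrArg (coeff k) h
  rw [coeff_map] at h'
  simp only [AlgHom.toRingHom_eq_coe, RingHom.coe_coe, MvPolynomial.aeval_X] at h'
  simp only [Matrix.cons_val_zero, Matrix.cons_val_one] at h'
  rw [A, polyA, map_mul, h', map_natCast]

end

/-! ### Linear differential equations with geometrically decaying coefficients -/

section

open Finset Topology

/-- The factors of the product tend to `σ < ρ`, so it is `O(ρ ^ m)`. -/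
theorem exists_prod_le_geometric {K σ ρ : ℝ} (hK : 0 ≤ K) (hσ : 0 ≤ σ) (hσρ : σ < ρ) :
    ∃ M : ℝ, ∀ m : ℕ, ∏ i ∈ range m, (σ + K / ((i : ℝ) + 1)) ≤ M * ρ ^ m := by
  have hρ : 0 < ρ := hσ.trans_lt hσρ
  set q : ℕ → ℝ := fun m => ∏ i ∈ range m, (σ + K / ((i : ℝ) + 1)) with hq
  obtain ⟨r, hr1, hr2⟩ := exists_between ((div_lt_one hρ).2 hσρ)
  have hlim : Tendsto (fun m : ℕ => (σ + K / ((m : ℝ) + 1)) / ρ) atTop (𝓝 (σ / ρ)) := by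
    have h := (tendsto_one_div_add_atTop_nhds_zero_nat (𝕜 := ℝ)).const_mul K
    have h2 := (h.const_add σ).div_const ρ
    simpa [div_eq_mul_inv] using h2
  have hq0 : ∀ m, 0 ≤ q m := fun m => prod_nonneg fun i _ => by positivity
  have hsum : Summable fun m => q m / ρ ^ m := by
    refine summable_of_ratio_norm_eventually_le hr2 ?_
    filter_upwards [hlim.eventually_le_const hr1] with m hm
    have hs : q (m + 1) / ρ ^ (m + 1) = (σ + K / ((m : ℝ) + 1)) / ρ * (q m / ρ ^ m) := by
      rw [hq]
      simp only [prod_range_succ]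
      field_simp
      ring
    rw [hs, norm_mul]
    gcongr
    rw [Real.norm_of_nonneg (by positivity)]
    exact hm
  obtain ⟨M, hM⟩ := hsum.tendsto_atTop_zero.bddAbove_range
  refine ⟨M, fun m => ?_⟩
  rw [← div_le_iff₀ (by positivity)]
  exact hM ⟨m, rfl⟩

/-- If the formal power series `p` solves `p' = c * p` and the coefficients of `c` decay
geometrically, then so do those of `p`, with constants that do not depend on `p` and `c`. -/
theorem exists_geometric_bound_of_recurrence {K σ ρ : ℝ} (hK : 0 ≤ K) (hσ : 0 ≤ σ)
    (hσρ : σ < ρ) :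
    ∃ M : ℝ, ∀ p c : ℕ → ℂ, p 0 = 1 →
      (∀ m : ℕ, ((m : ℂ) + 1) * p (m + 1) = ∑ ij ∈ antidiagonal m, c ij.1 * p ij.2) →
      (∀ i, ‖c i‖ ≤ K * σ ^ i) → ∀ m, ‖p m‖ ≤ M * ρ ^ m := by
  obtain ⟨M, hM⟩ := exists_prod_le_geometric hK hσ hσρ
  refine ⟨M, fun p c hp0 hrec hc m => ?_⟩
  -- `K * b m` dominates the right-hand side of the recurrence, and `b` itself grows by at most the
  -- factor `σ + K / (m + 1)` at each step.
  set b : ℕ → ℝ := fun m => ∑ ij ∈ antidiagonal m, σ ^ ij.1 * ‖p ij.2‖ with hb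
  have hpb (m : ℕ) : ‖p (m + 1)‖ ≤ K / ((m : ℝ) + 1) * b m := by
    have hm : (0 : ℝ) < (m : ℝ) + 1 := by positivity
    have h1 : ((m : ℝ) + 1) * ‖p (m + 1)‖ ≤ K * b m := by
      have h2 : ((m : ℝ) + 1) * ‖p (m + 1)‖ = ‖((m : ℂ) + 1) * p (m + 1)‖ := by
        rw [norm_mul]
        congr 1
        exact_mod_cast (Complex.norm_natCast (m + 1)).symm
      rw [h2, hrec, hb, mul_sum]
      refine (norm_sum_le _ _).trans (sum_le_sum fun ij _ => ?_)
      rw [norm_mul, ← mul_assoc]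
      gcongr
      exact hc _
    rw [div_mul_eq_mul_div, le_div_iff₀ hm, mul_comm]
    exact h1
  have hbs (m : ℕ) : b (m + 1) ≤ b m * (σ + K / ((m : ℝ) + 1)) := by
    have h1 : b (m + 1) = ‖p (m + 1)‖ + σ * b m := by
      simp only [hb, Finset.Nat.sum_antidiagonal_succ, pow_zero, one_mul, mul_sum, pow_succ]
      congr 1
      exact sum_congr rfl fun ij _ => by ring
    rw [h1]
    linarith [hpb m]
  have hbq (m : ℕ) : b m ≤ ∏ i ∈ range m, (σ + K / ((i : ℝ) + 1)) := by
    induction m with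
    | zero => simp [hb, hp0]
    | succ m ih =>
      rw [prod_range_succ]
      exact (hbs m).trans (by gcongr)
  have hle : ‖p m‖ ≤ b m := by
    have h := single_le_sum (f := fun ij : ℕ × ℕ => σ ^ ij.1 * ‖p ij.2‖)
      (fun ij _ => by positivity) (show ((0, m) : ℕ × ℕ) ∈ antidiagonal m by simp)
    simpa using h
  exact hle.trans ((hbq m).trans (hM m))

theorem hasDerivAt_tsum_mul_pow {p : ℕ → ℂ} {M ρ R : ℝ} (hρ : 0 < ρ) (hR : 1 ≤ R)
    (hρR : ρ * R < 1) (hp : ∀ m, ‖p m‖ ≤ M * ρ ^ m) {r : ℝ} (hr : r ∈ Set.Ioo (-R) R) :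
    HasDerivAt (fun r : ℝ => ∑' m, p m * (r : ℂ) ^ m)
      (∑' m : ℕ, ((m : ℂ) + 1) * p (m + 1) * (r : ℂ) ^ m) r := by
  have hM : 0 ≤ M := by simpa using (norm_nonneg _).trans (hp 0)
  have hR0 : 0 < R := by linarith
  have hu : Summable fun m : ℕ => M * ((m : ℝ) ^ 1 * (ρ * R) ^ m) :=
    (summable_pow_mul_geometric_of_norm_lt_one 1
      (by rwa [Real.norm_of_nonneg (by positivity)])).mul_left M
  have hbound (m : ℕ) (y : ℝ) (hy : y ∈ Set.Ioo (-R) R) :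
      ‖p m * ((m : ℂ) * (y : ℂ) ^ (m - 1))‖ ≤ M * ((m : ℝ) ^ 1 * (ρ * R) ^ m) := by
    have hy' : |y| ≤ R := (abs_lt.2 hy).le
    have h1 : |y| ^ (m - 1) ≤ R ^ m :=
      (pow_le_pow_left₀ (abs_nonneg _) hy' _).trans (pow_le_pow_right₀ hR (Nat.sub_le _ _))
    rw [norm_mul, norm_mul, norm_pow, Complex.norm_natCast, Complex.norm_real, Real.norm_eq_abs]
    calc ‖p m‖ * (m * |y| ^ (m - 1)) ≤ (M * ρ ^ m) * (m * R ^ m) := by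
          gcongr
          exact hp m
      _ = M * ((m : ℝ) ^ 1 * (ρ * R) ^ m) := by rw [mul_pow]; ring
  have hterm (m : ℕ) (y : ℝ) :
      HasDerivAt (fun r : ℝ => p m * (r : ℂ) ^ m) (p m * ((m : ℂ) * (y : ℂ) ^ (m - 1))) y := by
    have h := ((hasDerivAt_id (y : ℂ)).pow m).comp_ofReal
    simpa using h.const_mul (p m)
  have h0 : Summable fun m => p m * ((0 : ℝ) : ℂ) ^ m :=
    summable_of_ne_finset_zero (s := {0}) fun m hm => by
      rw [Finset.mem_singleton] at hm
      simp [hm]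
  have h := hasDerivAt_tsum_of_isPreconnected hu isOpen_Ioo isPreconnected_Ioo
    (fun m y _ => hterm m y) hbound (y₀ := 0) ⟨by linarith, hR0⟩ h0 hr
  have hs : Summable fun m : ℕ => p m * ((m : ℂ) * (r : ℂ) ^ (m - 1)) :=
    Summable.of_norm_bounded hu fun m => hbound m r hr
  rw [hs.tsum_eq_zero_add] at h
  convert! h using 1
  simp only [Nat.cast_zero, zero_mul, mul_zero, zero_add, Nat.cast_add, Nat.cast_one,
    Nat.add_sub_cancel]
  exact tsum_congr fun m => by ring

/-- The solution of `p' = c * p` with `p(0) = 1` is `exp (∫ c)`; here it is evaluated at `1`, a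
point inside the disc of convergence. -/
theorem hasSum_exp_of_recurrence {p c : ℕ → ℂ} {M K ρ : ℝ} {s : ℂ} (hρ : 0 < ρ) (hρ1 : ρ < 1)
    (hp0 : p 0 = 1)
    (hrec : ∀ m : ℕ, ((m : ℂ) + 1) * p (m + 1) = ∑ ij ∈ antidiagonal m, c ij.1 * p ij.2)
    (hp : ∀ m, ‖p m‖ ≤ M * ρ ^ m) (hc : ∀ i, ‖c i‖ ≤ K * ρ ^ i)
    (hs : HasSum (fun i : ℕ => c i / ((i : ℂ) + 1)) s) :
    HasSum p (Complex.exp s) := by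
  obtain ⟨R, hR1, hR2⟩ := exists_between (one_lt_inv_iff₀.2 ⟨hρ, hρ1⟩)
  have hρR : ρ * R < 1 := by
    calc ρ * R < ρ * ρ⁻¹ := by gcongr
      _ = 1 := mul_inv_cancel₀ hρ.ne'
  have hK : 0 ≤ K := by simpa using (norm_nonneg _).trans (hc 0)
  -- `l` is the sequence of coefficients of the primitive of `c`.
  set l : ℕ → ℂ := fun m => c (m - 1) / m with hl
  have hl0 : l 0 = 0 := by simp [hl]
  have hlb (m : ℕ) : ‖l m‖ ≤ K / ρ * ρ ^ m := by
    cases m with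
    | zero => rw [hl0, norm_zero]; positivity
    | succ m =>
      have h1 : (1 : ℝ) ≤ ((m + 1 : ℕ) : ℝ) := by exact_mod_cast Nat.succ_pos m
      rw [hl]
      simp only [Nat.add_sub_cancel, norm_div, Complex.norm_natCast]
      calc ‖c m‖ / ((m + 1 : ℕ) : ℝ) ≤ ‖c m‖ := div_le_self (norm_nonneg _) h1
        _ ≤ K * ρ ^ m := hc m
        _ = K / ρ * ρ ^ (m + 1) := by rw [pow_succ]; field_simp
  -- On the segment from `0` to `1`, `f' = g' f`, so `f * exp (-g)` is constant.
  set f : ℝ → ℂ := fun r => ∑' m, p m * (r : ℂ) ^ m with hf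
  set g : ℝ → ℂ := fun r => ∑' m, l m * (r : ℂ) ^ m with hg
  have hgeom (q : ℕ → ℂ) (L : ℝ) (hq : ∀ m, ‖q m‖ ≤ L * ρ ^ m) {r : ℝ}
      (hr : r ∈ Set.Ioo (-R) R) : Summable fun m => ‖q m * (r : ℂ) ^ m‖ := by
    have hL : 0 ≤ L := by simpa using (norm_nonneg _).trans (hq 0)
    refine Summable.of_nonneg_of_le (fun _ => norm_nonneg _) (fun m => ?_)
      ((summable_geometric_of_lt_one (by positivity) hρR).mul_left L)
    rw [norm_mul, norm_pow, Complex.norm_real, Real.norm_eq_abs, mul_pow, ← mul_assoc]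
    have := (abs_lt.2 hr).le
    gcongr
    exact hq m
  have hf' {r : ℝ} (hr : r ∈ Set.Ioo (-R) R) :
      HasDerivAt f ((∑' i, c i * (r : ℂ) ^ i) * f r) r := by
    have h := hasDerivAt_tsum_mul_pow hρ hR1.le hρR hp hr
    convert! h using 1
    rw [hf, tsum_mul_tsum_eq_tsum_sum_antidiagonal_of_summable_norm (hgeom c K hc hr)
      (hgeom p M hp hr)]
    refine tsum_congr fun m => ?_
    rw [hrec, sum_mul]
    refine sum_congr rfl fun ij hij => ?_
    rw [← mem_antidiagonal.1 hij, pow_add]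
    ring
  have hg' {r : ℝ} (hr : r ∈ Set.Ioo (-R) R) :
      HasDerivAt g (∑' i, c i * (r : ℂ) ^ i) r := by
    have h := hasDerivAt_tsum_mul_pow hρ hR1.le hρR hlb hr
    convert! h using 1
    refine tsum_congr fun m => ?_
    have hm : (m : ℂ) + 1 ≠ 0 := by exact_mod_cast Nat.succ_ne_zero m
    simp only [hl, Nat.add_sub_cancel, Nat.cast_add, Nat.cast_one]
    field_simp
  have hF {r : ℝ} (hr : r ∈ Set.Ioo (-R) R) :
      HasDerivAt (fun r => f r * Complex.exp (-g r)) 0 r := by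
    have h := (hf' hr).mul (hg' hr).neg.cexp
    convert! h using 1
    ring
  have hsub {r : ℝ} (hr : r ∈ Set.Icc (0 : ℝ) 1) : r ∈ Set.Ioo (-R) R :=
    ⟨by linarith [hr.1], by linarith [hr.2]⟩
  have hconst := constant_of_has_deriv_right_zero
    (fun r hr => (hF (hsub hr)).continuousAt.continuousWithinAt)
    (fun r hr => (hF (hsub (Set.Ico_subset_Icc_self hr))).hasDerivWithinAt) 1
    (Set.right_mem_Icc.2 zero_le_one)
  have hat0 (q : ℕ → ℂ) : ∑' m, q m * ((0 : ℝ) : ℂ) ^ m = q 0 := by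
    rw [tsum_eq_single 0 fun m hm => by simp [hm]]
    simp
  have hg1 : g 1 = s := by
    have hs' : HasSum l s := by
      rw [← hasSum_nat_add_iff' 1]
      simpa [hl] using hs
    simpa [hg] using hs'.tsum_eq
  have hf1 : f 1 = Complex.exp s := by
    have h : f 1 * Complex.exp (-g 1) = 1 := by
      rw [hconst]
      simp only [hf, hg, hat0, hp0, hl0]
      simp
    rw [hg1, Complex.exp_neg] at h
    field_simp at h
    exact h
  have hsum : Summable p := by
    have h := (hgeom p M hp (hsub (Set.right_mem_Icc.2 zero_le_one))).of_norm
    simpa using h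
  rw [← hf1, hf]
  simpa using hsum.hasSum

end

/-! ### Coefficients of the singular factor -/

section

open Finset Topology

/-- The coefficient of `s ^ j` in `(1 - s) ^ (-ν)`. -/
noncomputable def negBinomCoeff (ν : ℝ) (j : ℕ) : ℝ :=
  ∏ i ∈ range j, (ν + i) / ((i : ℝ) + 1)

/-- The linear terms of `1 + ν y` and `(1 + y) ^ (-ν)` cancel, so their product is `1 + O(y ^ 2)`.
With `y = 1 / n` this is the ratio of consecutive normalized binomial coefficients. -/
theorem abs_one_add_mul_mul_rpow_sub_one_le (ν : ℝ) {y : ℝ} (hy0 : 0 ≤ y) (hy1 : y ≤ 1) :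
    |(1 + ν * y) * (1 + y) ^ (-ν) - 1| ≤ |ν * (1 - ν)| * 2 ^ (|ν| + 1) * y ^ 2 := by
  have hd (t : ℝ) (ht : t ∈ Set.Icc 0 y) :
      HasDerivWithinAt (fun t : ℝ => (1 + ν * t) * (1 + t) ^ (-ν))
        (ν * (1 - ν) * t * (1 + t) ^ (-ν - 1)) (Set.Icc 0 y) t := by
    have ht0 : 0 < 1 + t := by linarith [ht.1]
    have h1 : HasDerivAt (fun t : ℝ => 1 + ν * t) ν t := by
      simpa using ((hasDerivAt_id t).const_mul ν).const_add 1
    have h2 : HasDerivAt (fun t : ℝ => (1 + t) ^ (-ν)) (1 * -ν * (1 + t) ^ (-ν - 1)) t :=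
      ((hasDerivAt_id t).const_add 1).rpow_const (Or.inl ht0.ne')
    have h3 : (1 + t) ^ (-ν) = (1 + t) ^ (-ν - 1) * (1 + t) := by
      rw [← Real.rpow_add_one ht0.ne', sub_add_cancel]
    convert! (h1.mul h2).hasDerivWithinAt using 1
    rw [h3]
    ring
  have hb (t : ℝ) (ht : t ∈ Set.Icc 0 y) :
      ‖ν * (1 - ν) * t * (1 + t) ^ (-ν - 1)‖ ≤ |ν * (1 - ν)| * 2 ^ (|ν| + 1) * y := by
    have ht0 : 0 < 1 + t := by linarith [ht.1]
    have h1 : (1 + t) ^ (-ν - 1) ≤ 2 ^ (|ν| + 1) :=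
      (Real.rpow_le_rpow_of_exponent_le (by linarith [ht.1])
        (by linarith [neg_abs_le ν, abs_nonneg ν] : -ν - 1 ≤ |ν| + 1)).trans
        (Real.rpow_le_rpow ht0.le (by linarith [ht.2]) (by positivity))
    rw [norm_mul, norm_mul, Real.norm_eq_abs, Real.norm_of_nonneg ht.1,
      Real.norm_of_nonneg (by positivity), mul_right_comm]
    gcongr
    exacts [ht.1, ht.2]
  have h := (convex_Icc (0 : ℝ) y).norm_image_sub_le_of_norm_hasDerivWithin_le hd hb
    (Set.left_mem_Icc.2 hy0) (Set.right_mem_Icc.2 hy0)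
  simp only [mul_zero, add_zero, Real.one_rpow, mul_one, sub_zero, Real.norm_eq_abs,
    abs_of_nonneg hy0] at h
  rw [sq, ← mul_assoc]
  exact h

/-- The tail of `∑ 1 / n ^ 2` is compared with the telescoping sum of `2 (1 / n - 1 / (n + 1))`. -/
theorem abs_sub_le_of_abs_sub_succ_le {b : ℕ → ℝ} {D L : ℝ} (hlim : Tendsto b atTop (𝓝 L))
    (hb : ∀ n : ℕ, 1 ≤ n → |b (n + 1) - b n| ≤ D / (n : ℝ) ^ 2) (n : ℕ) (hn : 1 ≤ n) :
    |b n - L| ≤ 2 * D / n := by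
  have hD : 0 ≤ D := by simpa using (abs_nonneg _).trans (hb 1 le_rfl)
  have hN (N : ℕ) (h : n ≤ N) : |b N - b n| ≤ 2 * D * (1 / n - 1 / N) := by
    induction N, h using Nat.le_induction with
    | base => simp
    | succ N h ih =>
      have hN0 : (1 : ℝ) ≤ N := by exact_mod_cast hn.trans h
      have h1 : D / (N : ℝ) ^ 2 ≤ 2 * D * (1 / N - 1 / (N + 1)) := by
        have h2 : (1 : ℝ) / N - 1 / (N + 1) = 1 / (N * (N + 1)) := by field_simp; ring
        rw [h2, mul_one_div, div_le_div_iff₀ (by positivity) (by positivity)]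
        nlinarith [mul_nonneg hD (mul_nonneg (sub_nonneg.2 hN0) (by linarith : (0 : ℝ) ≤ N))]
      push_cast
      calc |b (N + 1) - b n| ≤ |b (N + 1) - b N| + |b N - b n| := abs_sub_le _ _ _
        _ ≤ 2 * D * (1 / N - 1 / (N + 1)) + 2 * D * (1 / n - 1 / N) :=
          add_le_add ((hb N (hn.trans h)).trans h1) ih
        _ = 2 * D * (1 / n - 1 / (N + 1)) := by ring
  have h1 : Tendsto (fun N => |b N - b n|) atTop (𝓝 |L - b n|) := (hlim.sub_const _).abs
  rw [abs_sub_comm]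
  refine le_of_tendsto h1 ?_
  filter_upwards [eventually_ge_atTop n] with N h
  refine (hN N h).trans ?_
  rw [div_eq_mul_one_div (2 * D)]
  gcongr
  have : (0 : ℝ) ≤ 1 / N := by positivity
  linarith

theorem tendsto_negBinomCoeff_mul_rpow {ν : ℝ} (hν : ∀ m : ℕ, ν ≠ -(m : ℝ)) :
    Tendsto (fun n : ℕ => Real.Gamma ν * (negBinomCoeff ν n * (n : ℝ) ^ (1 - ν))) atTop
      (𝓝 1) := by
  have hΓ := Real.Gamma_ne_zero hν
  have h1 : Tendsto (fun n : ℕ => (n : ℝ) / (n + ν)) atTop (𝓝 1) := by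
    exact tendsto_natCast_div_add_atTop ν
  have h2 := (h1.div (Real.GammaSeq_tendsto_Gamma ν) hΓ).const_mul (Real.Gamma ν)
  rw [mul_one_div_cancel hΓ] at h2
  refine h2.congr' ?_
  filter_upwards [eventually_ge_atTop 1] with n hn
  have hn0 : (0 : ℝ) < n := by exact_mod_cast hn
  have hne (i : ℕ) : ν + i ≠ 0 := fun h => hν i (eq_neg_of_add_eq_zero_left h)
  have hprod : ∏ i ∈ range n, (ν + i) ≠ 0 := prod_ne_zero_iff.2 fun i _ => hne i
  have hfac : ∏ i ∈ range n, ((i : ℝ) + 1) = n.factorial := by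
    rw [← prod_range_add_one_eq_factorial]
    push_cast
    rfl
  have hne' : (n : ℝ) + ν ≠ 0 := by rw [add_comm]; exact hne n
  have hnν : (n : ℝ) ^ ν ≠ 0 := (Real.rpow_pos_of_pos hn0 ν).ne'
  have hf : (n.factorial : ℝ) ≠ 0 := by positivity
  congr 1
  simp only [Pi.div_apply]
  rw [Real.GammaSeq, negBinomCoeff, prod_div_distrib, hfac, prod_range_succ,
    Real.rpow_sub hn0, Real.rpow_one, add_comm ν n]
  field_simp

/-- The Gamma-function asymptotics of the binomial coefficients, with an error of relative
order `1 / j`. -/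
theorem exists_negBinomCoeff_bound {ν : ℝ} (hν : ∀ m : ℕ, ν ≠ -(m : ℝ)) :
    ∃ C : ℝ, 0 ≤ C ∧ ∀ j : ℕ, 1 ≤ j →
      |Real.Gamma ν * (negBinomCoeff ν j * (j : ℝ) ^ (1 - ν)) - 1| ≤ C / j := by
  set b : ℕ → ℝ := fun n => Real.Gamma ν * (negBinomCoeff ν n * (n : ℝ) ^ (1 - ν)) with hb
  have hlim : Tendsto b atTop (𝓝 1) := tendsto_negBinomCoeff_mul_rpow hν
  obtain ⟨B, hB⟩ := hlim.abs.bddAbove_range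
  have hB' (n : ℕ) : |b n| ≤ B := hB ⟨n, rfl⟩
  have hB0 : 0 ≤ B := (abs_nonneg _).trans (hB' 0)
  set D : ℝ := |ν * (1 - ν)| * 2 ^ (|ν| + 1) with hD
  have hD0 : 0 ≤ D := by positivity
  refine ⟨2 * (B * D), by positivity, abs_sub_le_of_abs_sub_succ_le hlim fun n hn => ?_⟩
  have hn0 : (0 : ℝ) < n := by exact_mod_cast hn
  have hy := abs_one_add_mul_mul_rpow_sub_one_le ν (y := 1 / n) (by positivity)
    (by rw [div_le_one hn0]; exact_mod_cast hn)
  have hstep : b (n + 1) - b n =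
      b n * ((1 + ν * (1 / n)) * (1 + 1 / n) ^ (-ν) - 1) := by
    have h1 : ((n + 1 : ℕ) : ℝ) = n * (1 + 1 / n) := by push_cast; field_simp
    have h0 : (0 : ℝ) < 1 + 1 / n := by positivity
    have h2 : ((n : ℝ) * (1 + 1 / n)) ^ (1 - ν) =
        (n : ℝ) ^ (1 - ν) * ((1 + 1 / n) ^ (-ν) * (1 + 1 / n)) := by
      rw [Real.mul_rpow hn0.le h0.le, ← Real.rpow_add_one h0.ne']
      congr 2
      ring
    simp only [hb]
    rw [h1, h2, negBinomCoeff, prod_range_succ, ← negBinomCoeff]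
    field_simp
    ring
  rw [hstep, abs_mul]
  calc |b n| * |(1 + ν * (1 / n)) * (1 + 1 / n) ^ (-ν) - 1|
      ≤ B * (D * (1 / n) ^ 2) := mul_le_mul (hB' n) hy (abs_nonneg _) hB0
    _ = B * D / n ^ 2 := by ring

/-- The coefficient of `u ^ n` in `(1 + u ^ 2) ^ (-ν)`. -/
noncomputable def singCoeff (ν : ℝ) (n : ℕ) : ℝ :=
  if Even n then (-1) ^ (n / 2) * negBinomCoeff ν (n / 2) else 0

theorem singCoeff_two_mul (ν : ℝ) (j : ℕ) :
    singCoeff ν (2 * j) = (-1) ^ j * negBinomCoeff ν j := by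
  simp [singCoeff]

theorem singCoeff_two_mul_add_one (ν : ℝ) (j : ℕ) : singCoeff ν (2 * j + 1) = 0 := by
  simp [singCoeff]

theorem exists_singCoeff_bound {ν : ℝ} (hν : ∀ m : ℕ, ν ≠ -(m : ℝ)) :
    ∃ C : ℝ, 0 ≤ C ∧ ∀ n : ℕ, 1 ≤ n →
      |singCoeff ν n * Real.Gamma ν * ((n : ℝ) / 2) ^ (1 - ν) - Real.cos (Real.pi / 2 * n)|
        ≤ C / n := by
  obtain ⟨C, hC, h⟩ := exists_negBinomCoeff_bound hν
  refine ⟨2 * C, by positivity, fun n hn => ?_⟩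
  rcases Nat.even_or_odd' n with ⟨j, rfl | rfl⟩
  · have hj : 1 ≤ j := by omega
    have h1 : Real.cos (Real.pi / 2 * ((2 * j : ℕ) : ℝ)) = (-1) ^ j := by
      rw [← Real.cos_nat_mul_pi]
      push_cast
      ring_nf
    have h2 : ((2 * j : ℕ) : ℝ) / 2 = j := by push_cast; ring
    rw [singCoeff_two_mul, h1, h2, show (-1 : ℝ) ^ j * negBinomCoeff ν j * Real.Gamma ν *
      (j : ℝ) ^ (1 - ν) - (-1) ^ j = (-1) ^ j *
        (Real.Gamma ν * (negBinomCoeff ν j * (j : ℝ) ^ (1 - ν)) - 1) by ring, abs_mul, abs_pow,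
      abs_neg, abs_one, one_pow, one_mul]
    refine (h j hj).trans_eq ?_
    push_cast
    rw [mul_div_mul_left _ _ two_ne_zero]
  · have h1 : Real.cos (Real.pi / 2 * ((2 * j + 1 : ℕ) : ℝ)) = 0 :=
      Real.cos_eq_zero_iff.2 ⟨j, by push_cast; ring⟩
    rw [singCoeff_two_mul_add_one, h1]
    simp only [zero_mul, sub_zero, abs_zero]
    positivity

theorem abs_rpow_sub_one_le {q : ℝ} (hq : 1 ≤ q) (γ : ℝ) :
    |q ^ γ - 1| ≤ |γ| * (q - 1) * q ^ |γ| := by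
  have hq0 : 0 < q := by linarith
  have hexp (s : ℝ) : |Real.exp s - 1| ≤ |s| * Real.exp |s| := by
    have h1 := Real.add_one_le_exp s
    have h2 := Real.add_one_le_exp (-s)
    have h3 : Real.exp s * Real.exp (-s) = 1 := by rw [← Real.exp_add]; simp
    have h4 := Real.exp_pos s
    have h5 : Real.exp s ≤ Real.exp |s| := Real.exp_le_exp.2 (le_abs_self s)
    have h6 : (1 : ℝ) ≤ Real.exp |s| := Real.one_le_exp (abs_nonneg s)
    rcases le_total 0 s with hs | hs
    · rw [abs_of_nonneg (by linarith), abs_of_nonneg hs]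
      nlinarith
    · rw [abs_of_nonpos (by linarith [Real.exp_le_one_iff.2 hs]), abs_of_nonpos hs] at *
      nlinarith
  have hlog : 0 ≤ Real.log q := Real.log_nonneg hq
  have hlog' : Real.log q ≤ q - 1 := Real.log_le_sub_one_of_pos hq0
  have h := hexp (Real.log q * γ)
  rw [abs_mul, abs_of_nonneg hlog, ← Real.rpow_def_of_pos hq0, ← Real.rpow_def_of_pos hq0] at h
  refine h.trans ?_
  rw [mul_comm (Real.log q)]
  gcongr

/-- Normalized, the coefficient of `u ^ (k - m)` in `(1 + u ^ 2) ^ (-ν)` is `cos (π (k - m) / 2)`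
up to `O (1 / k)`, with a constant that grows polynomially in `m`. The bound holds for all `m`,
so that no splitting of the convolution sum is needed. -/
theorem exists_normalized_singCoeff_bound {ν : ℝ} (hν : ∀ m : ℕ, ν ≠ -(m : ℝ)) :
    ∃ (C : ℝ) (B : ℕ), 0 ≤ C ∧ ∀ k : ℕ, 1 ≤ k → ∀ m : ℕ,
      |(if m ≤ k then singCoeff ν (k - m) * Real.Gamma ν * ((k : ℝ) / 2) ^ (1 - ν) else 0) -
        Real.cos (Real.pi / 2 * ((k : ℝ) - m))| ≤ C * ((1 + m : ℝ) ^ B) / k := by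
  obtain ⟨C₁, hC₁, h₁⟩ := exists_singCoeff_bound hν
  set γ : ℝ := 1 - ν with hγ
  set G : ℝ := |Real.Gamma ν| * 2 ^ |γ| with hG
  have hG0 : 0 ≤ G := by positivity
  obtain ⟨B, hB⟩ := exists_nat_ge (|γ| + 2)
  refine ⟨C₁ + |γ| + G + 1, B, by positivity, fun k hk m => ?_⟩
  have hk0 : (0 : ℝ) < k := by exact_mod_cast hk
  have hm0 : (1 : ℝ) ≤ 1 + m := by linarith [Nat.cast_nonneg (α := ℝ) m]
  have hpow {s : ℝ} (hs : s ≤ |γ| + 2) : (1 + m : ℝ) ^ s ≤ (1 + m : ℝ) ^ B := by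
    rw [← Real.rpow_natCast]
    exact Real.rpow_le_rpow_of_exponent_le hm0 (hs.trans hB)
  rw [le_div_iff₀ hk0]
  set P : ℝ := (1 + m : ℝ) ^ B with hP
  have hP1 : 1 ≤ P := one_le_pow₀ hm0
  have hP2 : (1 + m : ℝ) ≤ P := by simpa using hpow (s := 1) (by linarith [abs_nonneg γ])
  rcases lt_trichotomy m k with hmk | rfl | hmk
  · obtain ⟨n, rfl⟩ := Nat.exists_eq_add_of_lt hmk
    set n' := n + 1 with hn'
    have hn1 : (1 : ℝ) ≤ n' := by exact_mod_cast Nat.succ_pos n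
    have hn0 : (0 : ℝ) < n' := by linarith
    have hk' : ((m + n + 1 : ℕ) : ℝ) = m + n' := by push_cast [hn']; ring
    rw [if_pos hmk.le, show m + n + 1 - m = n' by omega, hk']
    rw [hk'] at hk0
    -- Both errors carry a power of `q = k / n'`, where `n' = k - m`; it is at most `1 + m`.
    set q : ℝ := (m + n') / n' with hq
    have hq1 : 1 ≤ q := by
      rw [hq, le_div_iff₀ hn0]
      linarith [Nat.cast_nonneg (α := ℝ) m]
    have hq0 : 0 < q := by linarith
    have hqm : q ≤ 1 + m := by
      rw [hq, div_le_iff₀ hn0]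
      nlinarith [Nat.cast_nonneg (α := ℝ) m]
    have hnq : n' * q = m + n' := by rw [hq]; field_simp
    have hqγ : q ^ γ ≤ q ^ |γ| := Real.rpow_le_rpow_of_exponent_le hq1 (le_abs_self γ)
    have hqP : q * q ^ |γ| ≤ P := by
      rw [mul_comm, ← Real.rpow_add_one hq0.ne']
      exact (Real.rpow_le_rpow hq0.le hqm (by positivity)).trans (hpow (by linarith))
    have hqP2 : m * (q * q ^ |γ|) ≤ P := by
      calc m * (q * q ^ |γ|) ≤ (1 + m) * ((1 + m) * (1 + m) ^ |γ|) := by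
            gcongr
            linarith
        _ = (1 + m : ℝ) ^ (|γ| + 2) := by
            rw [Real.rpow_add (by linarith), Real.rpow_two]
            ring
        _ ≤ P := hpow le_rfl
    have hsplit : ((m + n' : ℝ) / 2) ^ γ = ((n' : ℝ) / 2) ^ γ * q ^ γ := by
      rw [← Real.mul_rpow (by positivity) hq0.le, ← hnq]
      congr 1
      ring
    have hθ : Real.pi / 2 * ((m + n' : ℝ) - m) = Real.pi / 2 * n' := by ring
    rw [hsplit, hθ]
    set θ := Real.cos (Real.pi / 2 * n')
    have hθ1 : |θ| ≤ 1 := Real.abs_cos_le_one _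
    set β := singCoeff ν n' * Real.Gamma ν * ((n' : ℝ) / 2) ^ γ with hβ
    have hβθ : |β - θ| * n' ≤ C₁ := (le_div_iff₀ hn0).1 (h₁ n' (Nat.succ_pos n))
    have hA : |(β - θ) * q ^ γ| * (m + n') ≤ C₁ * P := by
      rw [abs_mul, abs_of_nonneg (by positivity : 0 ≤ q ^ γ), ← hnq]
      calc |β - θ| * q ^ γ * (n' * q) = (|β - θ| * n') * (q * q ^ γ) := by ring
        _ ≤ C₁ * (q * q ^ |γ|) := by gcongr
        _ ≤ C₁ * P := by gcongr
    have hBd : |θ * (q ^ γ - 1)| * (m + n') ≤ |γ| * P := by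
      rw [abs_mul]
      have hqm1 : (q - 1) * (m + n') = m * q := by
        rw [← hnq]
        have : n' * (q - 1) = (m : ℝ) := by linarith
        linear_combination q * this
      calc |θ| * |q ^ γ - 1| * (m + n') ≤ 1 * (|γ| * (q - 1) * q ^ |γ|) * (m + n') := by
            gcongr
            exact abs_rpow_sub_one_le hq1 γ
        _ = |γ| * (m * (q * q ^ |γ|)) := by linear_combination |γ| * q ^ |γ| * hqm1
        _ ≤ |γ| * P := by gcongr
    have hdec : singCoeff ν n' * Real.Gamma ν * (((n' : ℝ) / 2) ^ γ * q ^ γ) - θ =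
        (β - θ) * q ^ γ + θ * (q ^ γ - 1) := by rw [hβ]; ring
    rw [hdec]
    calc |(β - θ) * q ^ γ + θ * (q ^ γ - 1)| * (m + n')
        ≤ (|(β - θ) * q ^ γ| + |θ * (q ^ γ - 1)|) * (m + n') := by
          gcongr
          exact abs_add_le _ _
      _ ≤ (C₁ + |γ|) * P := by linarith
      _ ≤ (C₁ + |γ| + G + 1) * P :=
          mul_le_mul_of_nonneg_right (by linarith) (by linarith)
  -- For `m = k` no cancellation is needed: every term is polynomial in `k = m`.
  · have hs0 : singCoeff ν 0 = 1 := by simp [singCoeff, negBinomCoeff]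
    have hm1 : (1 : ℝ) ≤ m := by exact_mod_cast hk
    rw [if_pos le_rfl, Nat.sub_self, hs0, one_mul, sub_self, mul_zero, Real.cos_zero]
    have hhalf : ((m : ℝ) / 2) ^ γ ≤ 2 ^ |γ| * (m : ℝ) ^ |γ| := by
      rw [div_eq_mul_inv, Real.mul_rpow hk0.le (by positivity), Real.inv_rpow (by norm_num),
        ← Real.rpow_neg (by norm_num), mul_comm]
      gcongr
      · norm_num
      · exact neg_le_abs γ
      · exact le_abs_self γ
    have hmP : (m : ℝ) ^ |γ| * m ≤ P := by
      rw [← Real.rpow_add_one hk0.ne']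
      exact (Real.rpow_le_rpow hk0.le (by linarith) (by positivity)).trans (hpow (by linarith))
    calc |Real.Gamma ν * ((m : ℝ) / 2) ^ γ - 1| * m
        ≤ (|Real.Gamma ν| * (2 ^ |γ| * (m : ℝ) ^ |γ|) + 1) * m := by
          gcongr
          refine (abs_sub _ _).trans ?_
          rw [abs_mul, abs_one, abs_of_nonneg (by positivity : 0 ≤ ((m : ℝ) / 2) ^ γ)]
          gcongr
      _ = G * ((m : ℝ) ^ |γ| * m) + m := by rw [hG]; ring
      _ ≤ G * P + P := by
          gcongr
          linarith
      _ ≤ (C₁ + |γ| + G + 1) * P := by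
          nlinarith [mul_nonneg (add_nonneg hC₁ (abs_nonneg γ)) (zero_le_one.trans hP1)]
  -- For `m > k` the factor `(1 + m) / k` exceeds `1`.
  · rw [if_neg hmk.not_ge, zero_sub, abs_neg]
    have hmk' : (k : ℝ) ≤ m := by exact_mod_cast hmk.le
    calc |Real.cos (Real.pi / 2 * ((k : ℝ) - m))| * k ≤ 1 * P := by
          gcongr
          · exact Real.abs_cos_le_one _
          · linarith
      _ ≤ (C₁ + |γ| + G + 1) * P := by
          gcongr
          linarith [abs_nonneg γ]

end

/-! ### The sum of `(ζ(2 j) - 1) / j` -/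

section

open Finset Topology

/-- `ζ(2 (j + 1)) - 1`, written as a series over the integers `n + 2 ≥ 2`. -/
noncomputable def zetaEvenSubOne (j : ℕ) : ℝ :=
  ∑' n : ℕ, 1 / ((n : ℝ) + 2) ^ (2 * (j + 1))

theorem hasSum_one_div_add_two_pow (j : ℕ) :
    HasSum (fun n : ℕ => 1 / ((n : ℝ) + 2) ^ (2 * (j + 1)))
      ((-1 : ℝ) ^ j * (2 : ℝ) ^ (2 * j + 1) * Real.pi ^ (2 * (j + 1)) *
        bernoulli (2 * (j + 1)) / (2 * (j + 1)).factorial - 1) := by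
  have h := (hasSum_nat_add_iff' 2).2 (hasSum_zeta_nat (k := j + 1) (Nat.succ_ne_zero j))
  simp only [Nat.cast_add, Nat.cast_ofNat] at h
  convert! h using 1
  rw [show 2 * (j + 1) - 1 = 2 * j + 1 by omega, pow_add (-1 : ℝ) j 2, sum_range_succ,
    sum_range_one]
  simp [pow_succ]

theorem hasSum_zetaEvenSubOne (j : ℕ) :
    HasSum (fun n : ℕ => 1 / ((n : ℝ) + 2) ^ (2 * (j + 1))) (zetaEvenSubOne j) :=
  (hasSum_one_div_add_two_pow j).summable.hasSum

/-- Euler's formula for `ζ(2 (j + 1))`. -/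
theorem bernoulli_eq_zetaEvenSubOne (j : ℕ) :
    (2 * Real.pi) ^ (2 * (j + 1)) * ((bernoulli (2 * (j + 1)) : ℝ) / (2 * (j + 1)).factorial) =
      2 * (-1) ^ j * (1 + zetaEvenSubOne j) := by
  have h := (hasSum_zetaEvenSubOne j).unique (hasSum_one_div_add_two_pow j)
  have h1 : ((-1 : ℝ) ^ j) * (-1) ^ j = 1 := by rw [← mul_pow]; simp
  rw [h, mul_pow, show (2 : ℝ) ^ (2 * (j + 1)) = 2 * 2 ^ (2 * j + 1) by ring]
  linear_combination (-2 * (2 : ℝ) ^ (2 * j + 1) * Real.pi ^ (2 * (j + 1)) *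
    (bernoulli (2 * (j + 1)) / (2 * (j + 1)).factorial)) * h1

theorem zetaEvenSubOne_nonneg (j : ℕ) : 0 ≤ zetaEvenSubOne j :=
  tsum_nonneg fun n => by positivity

theorem zetaEvenSubOne_le (j : ℕ) : zetaEvenSubOne j ≤ zetaEvenSubOne 0 * (1 / 4) ^ j := by
  refine hasSum_le (fun n => ?_) (hasSum_zetaEvenSubOne j)
    ((hasSum_zetaEvenSubOne 0).mul_right ((1 / 4 : ℝ) ^ j))
  have h : 1 / ((n : ℝ) + 2) ^ (2 * (j + 1)) =
      1 / ((n : ℝ) + 2) ^ (2 * (0 + 1)) * (1 / ((n : ℝ) + 2) ^ 2) ^ j := by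
    rw [one_div_pow, ← pow_mul, one_div_mul_one_div, ← pow_add]
    ring_nf
  rw [h]
  gcongr
  nlinarith [Nat.cast_nonneg (α := ℝ) n]

/-- The logarithm of the telescoping product `∏_{n ≥ 2} (1 - 1 / n ^ 2) = 1 / 2`. -/
theorem hasSum_neg_log_one_sub_inv_sq :
    HasSum (fun n : ℕ => -Real.log (1 - 1 / ((n : ℝ) + 2) ^ 2)) (Real.log 2) := by
  set u : ℕ → ℝ := fun n => Real.log (1 + 1 / ((n : ℝ) + 1)) with hu
  have hterm (n : ℕ) : -Real.log (1 - 1 / ((n : ℝ) + 2) ^ 2) = u n - u (n + 1) := by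
    have h1 : (0 : ℝ) < 1 + 1 / ((n : ℝ) + 1) := by positivity
    have h2 : (0 : ℝ) < 1 + 1 / (((n + 1 : ℕ) : ℝ) + 1) := by positivity
    simp only [hu]
    rw [← Real.log_div h1.ne' h2.ne', ← Real.log_inv]
    congr 1
    have h3 : 1 - 1 / ((n : ℝ) + 2) ^ 2 = (n + 1) * (n + 3) / (n + 2) ^ 2 := by
      field_simp
      ring
    rw [h3]
    push_cast
    field_simp
    ring
  have hnonneg (n : ℕ) : 0 ≤ -Real.log (1 - 1 / ((n : ℝ) + 2) ^ 2) := by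
    have h1 : 1 / ((n : ℝ) + 2) ^ 2 ≤ 1 := by
      rw [div_le_one (by positivity)]
      nlinarith [Nat.cast_nonneg (α := ℝ) n]
    have h2 : 0 ≤ 1 / ((n : ℝ) + 2) ^ 2 := by positivity
    exact neg_nonneg.2 (Real.log_nonpos (by linarith) (by linarith))
  rw [hasSum_iff_tendsto_nat_of_nonneg hnonneg]
  simp only [hterm, sum_range_sub']
  have hlim : Tendsto u atTop (𝓝 0) := by
    have h := (tendsto_one_div_add_atTop_nhds_zero_nat (𝕜 := ℝ)).const_add 1
    rw [add_zero] at h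
    simpa [hu] using h.log one_ne_zero
  have h0 : u 0 = Real.log 2 := by
    simp only [hu]
    norm_num
  simpa [h0] using hlim.const_sub (u 0)

/-- `∑_{j ≥ 1} (ζ(2 j) - 1) / j = log 2`: expand `ζ(2 j) - 1` over `n ≥ 2` and sum over `j`
first. -/
theorem hasSum_zetaEvenSubOne_div :
    HasSum (fun j : ℕ => zetaEvenSubOne j / ((j : ℝ) + 1)) (Real.log 2) := by
  set F : ℕ × ℕ → ℝ := fun q => (1 / ((q.1 : ℝ) + 2) ^ 2) ^ (q.2 + 1) / ((q.2 : ℝ) + 1) with hF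
  have hrow (n : ℕ) : HasSum (fun j => F (n, j)) (-Real.log (1 - 1 / ((n : ℝ) + 2) ^ 2)) := by
    have hx : |1 / ((n : ℝ) + 2) ^ 2| < 1 := by
      rw [abs_of_nonneg (by positivity), div_lt_one (by positivity)]
      nlinarith [Nat.cast_nonneg (α := ℝ) n]
    simp only [hF]
    exact Real.hasSum_pow_div_log_of_abs_lt_one hx
  have hcol (j : ℕ) : HasSum (fun n => F (n, j)) (zetaEvenSubOne j / ((j : ℝ) + 1)) := by
    have h := (hasSum_zetaEvenSubOne j).div_const ((j : ℝ) + 1)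
    refine h.congr_fun fun n => ?_
    simp only [hF]
    rw [pow_mul, one_div_pow]
  have hsum : Summable F := by
    rw [summable_prod_of_nonneg fun q => by positivity]
    refine ⟨fun n => (hrow n).summable, ?_⟩
    simp only [(hrow _).tsum_eq]
    exact hasSum_neg_log_one_sub_inv_sq.summable
  have h1 : ∑' q, F q = Real.log 2 :=
    (hsum.hasSum.prod_fiberwise hrow).unique hasSum_neg_log_one_sub_inv_sq
  have h2 : HasSum (F ∘ Equiv.prodComm ℕ ℕ) (Real.log 2) :=
    (Equiv.hasSum_iff _).2 (h1 ▸ hsum.hasSum)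
  exact h2.prod_fiberwise hcol

end

/-! ### The regular factor -/

section

open Finset Topology PowerSeries

/-- The part of `2 π Θ'(2 π u)` that is regular in `|u| < 2`, namely
`2 π Θ'(2 π u) + 2 u / (1 + u ^ 2) = ∑ j, 2 (-1) ^ (j + 1) (ζ(2 (j + 1)) - 1) u ^ (2 j + 1)`. -/
noncomputable def regularPart : ℝ⟦X⟧ :=
  PowerSeries.mk fun n => if Even n then 0 else 2 * (-1) ^ (n / 2 + 1) * zetaEvenSubOne (n / 2)

theorem coeff_regularPart_even (j : ℕ) : coeff (2 * j) regularPart = 0 := by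
  simp [regularPart]

theorem coeff_regularPart_odd (j : ℕ) :
    coeff (2 * j + 1) regularPart = 2 * (-1) ^ (j + 1) * zetaEvenSubOne j := by
  have h : (2 * j + 1) / 2 = j := by omega
  simp [regularPart, h]

theorem derivative_rescale {R : Type*} [CommRing R] (c : R) (f : R⟦X⟧) :
    d⁄dX R (rescale c f) = C c * rescale c (d⁄dX R f) := by
  ext n
  rw [coeff_derivative, coeff_rescale, coeff_C_mul, coeff_rescale, coeff_derivative]
  ring

/-- The polar part of `2 π Θ'(2 π u)` is `-2 u / (1 + u ^ 2)`, the logarithmic derivative of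
`(1 + u ^ 2)⁻¹`. -/
theorem rescaled_derivative_theta_sub_regularPart :
    (C (2 * Real.pi) * rescale (2 * Real.pi) (PowerSeries.map (algebraMap ℚ ℝ) (d⁄dX ℚ theta)) -
      regularPart) * (1 + X ^ 2) = -2 * X := by
  set T : ℝ⟦X⟧ := C (2 * Real.pi) *
    rescale (2 * Real.pi) (PowerSeries.map (algebraMap ℚ ℝ) (d⁄dX ℚ theta)) - regularPart with hT
  have heven (j : ℕ) : coeff (2 * j) T = 0 := by
    rw [hT, map_sub, coeff_C_mul, coeff_rescale, coeff_map, coeff_derivative_theta_even,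
      coeff_regularPart_even]
    simp
  have hodd (j : ℕ) : coeff (2 * j + 1) T = 2 * (-1) ^ (j + 1) := by
    have h := bernoulli_eq_zetaEvenSubOne j
    rw [hT, map_sub, coeff_C_mul, coeff_rescale, coeff_map, coeff_derivative_theta_odd,
      coeff_regularPart_odd, map_neg, map_div₀, eq_ratCast, eq_ratCast, Rat.cast_natCast]
    rw [show 2 * (j + 1) = 2 * j + 1 + 1 by ring] at h ⊢
    linear_combination -h
  have hstep (n : ℕ) : coeff (n + 2) T = -coeff n T := by
    rcases Nat.even_or_odd' n with ⟨j, rfl | rfl⟩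
    · rw [show 2 * j + 2 = 2 * (j + 1) by ring, heven, heven, neg_zero]
    · rw [show 2 * j + 1 + 2 = 2 * (j + 1) + 1 by ring, hodd, hodd]
      ring
  have h2 : (-2 : ℝ⟦X⟧) * X = C (-2 : ℝ) * X := by
    rw [map_neg, map_ofNat]
  ext n
  rw [mul_add, mul_one, map_add, coeff_mul_X_pow', h2, coeff_C_mul, coeff_X]
  match n with
  | 0 => simpa using heven 0
  | 1 => simpa using hodd 0
  | n + 2 => simp [hstep]

/-- The differential equation of `(1 + u ^ 2) ^ (-ν)`. -/
theorem one_add_X_sq_mul_derivative_singCoeff (ν : ℝ) :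
    (1 + X ^ 2) * d⁄dX ℝ (PowerSeries.mk (singCoeff ν)) =
      C ν * (-2 * X) * PowerSeries.mk (singCoeff ν) := by
  have h2 : (-2 : ℝ⟦X⟧) = C (-2 : ℝ) := by rw [map_neg, map_ofNat]
  have hrhs : C ν * (-2 * X) * PowerSeries.mk (singCoeff ν) =
      C (ν * -2) * (PowerSeries.mk (singCoeff ν) * X) := by
    rw [h2, map_mul]
    ring
  ext n
  rw [hrhs, add_mul, one_mul, map_add, coeff_X_pow_mul', coeff_C_mul, coeff_derivative, coeff_mk]
  match n with
  | 0 =>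
    have h := singCoeff_two_mul_add_one ν 0
    simp at h
    simp [h]
  | 1 =>
    have h1 := singCoeff_two_mul ν 1
    have h0 := singCoeff_two_mul ν 0
    simp [negBinomCoeff] at h1 h0
    have hX := coeff_succ_mul_X 0 (PowerSeries.mk (singCoeff ν))
    rw [zero_add] at hX
    simp [hX, h1, h0]
    norm_num
  | n + 2 =>
    rw [coeff_succ_mul_X, if_pos (Nat.le_add_left 2 n), Nat.add_sub_cancel, coeff_derivative,
      coeff_mk]
    rcases Nat.even_or_odd' n with ⟨j, rfl | rfl⟩
    · rw [singCoeff_two_mul_add_one, show 2 * j + 2 + 1 = 2 * (j + 1) + 1 by ring,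
        singCoeff_two_mul_add_one]
      simp
    · rw [show 2 * j + 1 + 2 + 1 = 2 * (j + 2) by ring, show 2 * j + 1 + 1 = 2 * (j + 1) by ring,
        singCoeff_two_mul, singCoeff_two_mul, negBinomCoeff, prod_range_succ, ← negBinomCoeff]
      push_cast
      field_simp
      ring

/-- The quotient of `exp (x t) * exp (ν Θ(t))`, `t = 2 π u`, by its singular factor
`(1 + u ^ 2) ^ (-ν)`. -/
noncomputable def regularFactor (x ν : ℝ) : ℝ⟦X⟧ :=
  rescale (2 * Real.pi) (genSeries ℝ x ν) * (PowerSeries.mk (singCoeff ν))⁻¹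

theorem constantCoeff_mk_singCoeff (ν : ℝ) : constantCoeff (PowerSeries.mk (singCoeff ν)) = 1 := by
  simp [← coeff_zero_eq_constantCoeff_apply, singCoeff, negBinomCoeff]

theorem regularFactor_mul (x ν : ℝ) :
    regularFactor x ν * PowerSeries.mk (singCoeff ν) = rescale (2 * Real.pi) (genSeries ℝ x ν) := by
  rw [regularFactor, mul_assoc, PowerSeries.inv_mul_cancel, mul_one]
  rw [constantCoeff_mk_singCoeff]
  exact one_ne_zero

theorem coeff_zero_regularFactor (x ν : ℝ) : coeff 0 (regularFactor x ν) = 1 := by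
  have h : constantCoeff (rescale (2 * Real.pi) (genSeries ℝ x ν)) = 1 := by
    rw [← coeff_zero_eq_constantCoeff_apply, coeff_rescale, coeff_zero_eq_constantCoeff_apply,
      constantCoeff_genSeries]
    simp
  rw [coeff_zero_eq_constantCoeff_apply, regularFactor, map_mul, h, constantCoeff_inv,
    constantCoeff_mk_singCoeff]
  simp

theorem derivative_regularFactor (x ν : ℝ) :
    d⁄dX ℝ (regularFactor x ν) =
      (C (2 * Real.pi * x) + C ν * regularPart) * regularFactor x ν := by
  set α : ℝ⟦X⟧ := PowerSeries.mk (singCoeff ν) with hα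
  set T : ℝ⟦X⟧ := C (2 * Real.pi) *
    rescale (2 * Real.pi) (PowerSeries.map (algebraMap ℚ ℝ) (d⁄dX ℚ theta)) with hT
  have hα0 : α ≠ 0 := fun h => by
    have := constantCoeff_mk_singCoeff ν
    rw [← hα, h] at this
    simp at this
  have hX : (1 + X ^ 2 : ℝ⟦X⟧) ≠ 0 := fun h => by
    have := congrArg (constantCoeff (R := ℝ)) h
    simp at this
  have hdα : d⁄dX ℝ α = C ν * (T - regularPart) * α := by
    refine mul_left_cancel₀ hX ?_
    rw [one_add_X_sq_mul_derivative_singCoeff, ← rescaled_derivative_theta_sub_regularPart]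
    ring
  have hF := congrArg (d⁄dX ℝ) (regularFactor_mul x ν)
  have hCC (c : ℝ) : rescale (2 * Real.pi) (C c) = C c := by
    ext n
    rw [coeff_rescale, coeff_C]
    split_ifs with h <;> simp [h]
  rw [Derivation.leibniz, derivative_rescale, derivative_genSeries, map_mul (rescale _), map_add,
    map_mul (rescale _), ← regularFactor_mul, ← hα, hdα, hCC, hCC] at hF
  simp only [smul_eq_mul] at hF
  refine mul_right_cancel₀ hα0 ?_
  rw [map_mul]
  linear_combination hF

/-- The coefficients of `2 π x + ν * regularPart`, transported to the ray through `u = i`. -/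
noncomputable def logDerivCoeff (x ν : ℝ) (n : ℕ) : ℂ :=
  ((coeff n (C (2 * Real.pi * x) + C ν * regularPart) : ℝ) : ℂ) * Complex.I ^ (n + 1)

/-- The differential equation of the regular factor, read along the ray through `u = i`. -/
theorem regularFactor_recurrence (x ν : ℝ) (m : ℕ) :
    ((m : ℂ) + 1) * (((coeff (m + 1) (regularFactor x ν) : ℝ) : ℂ) * Complex.I ^ (m + 1)) =
      ∑ ij ∈ antidiagonal m, logDerivCoeff x ν ij.1 *
        (((coeff ij.2 (regularFactor x ν) : ℝ) : ℂ) * Complex.I ^ ij.2) := by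
  have h := congrArg (coeff m) (derivative_regularFactor x ν)
  rw [coeff_derivative, coeff_mul] at h
  have h' := congrArg (fun r : ℝ => (r : ℂ) * Complex.I ^ (m + 1)) h
  simp only [Complex.ofReal_mul, Complex.ofReal_add, Complex.ofReal_natCast, Complex.ofReal_one,
    Complex.ofReal_sum, sum_mul] at h'
  calc _ = _ := by ring
    _ = _ := h'
    _ = _ := sum_congr rfl fun ij hij => by
      rw [logDerivCoeff, ← mem_antidiagonal.1 hij]
      ring

theorem logDerivCoeff_odd (x ν : ℝ) (j : ℕ) :
    logDerivCoeff x ν (2 * j + 1) = ((2 * ν * zetaEvenSubOne j : ℝ) : ℂ) := by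
  have hI : Complex.I ^ (2 * j + 1 + 1) = (-1) ^ (j + 1) := by
    rw [show 2 * j + 1 + 1 = 2 * (j + 1) by ring, pow_mul, Complex.I_sq]
  have h1 : (-1 : ℂ) ^ (j + 1) * (-1) ^ (j + 1) = 1 := by rw [← mul_pow]; simp
  rw [logDerivCoeff, map_add, coeff_C_mul, coeff_regularPart_odd, coeff_C,
    if_neg (Nat.succ_ne_zero _), hI]
  push_cast
  linear_combination (2 * ν * zetaEvenSubOne j : ℂ) * h1

theorem logDerivCoeff_even (x ν : ℝ) (j : ℕ) :
    logDerivCoeff x ν (2 * j) = if j = 0 then 2 * Real.pi * x * Complex.I else 0 := by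
  rw [logDerivCoeff, map_add, coeff_C_mul, coeff_regularPart_even, coeff_C]
  rcases Nat.eq_zero_or_pos j with rfl | hj
  · simp
  · simp [hj.ne']

theorem norm_logDerivCoeff_le {x X₀ : ℝ} (ν : ℝ) (hx : |x| ≤ X₀) (n : ℕ) :
    ‖logDerivCoeff x ν n‖ ≤
      (2 * Real.pi * X₀ + 4 * |ν| * zetaEvenSubOne 0) * (1 / 2) ^ n := by
  have hX : 0 ≤ X₀ := (abs_nonneg x).trans hx
  have hz := zetaEvenSubOne_nonneg 0
  have hπ := Real.pi_pos
  rcases Nat.even_or_odd' n with ⟨j, rfl | rfl⟩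
  · rw [logDerivCoeff_even]
    split_ifs with h
    · subst h
      simp only [norm_mul, Complex.norm_I, Complex.norm_real, Real.norm_eq_abs, abs_of_pos hπ,
        Complex.norm_ofNat, mul_one, mul_zero, pow_zero]
      have h1 : 2 * Real.pi * |x| ≤ 2 * Real.pi * X₀ := by gcongr
      have h2 : 0 ≤ 4 * |ν| * zetaEvenSubOne 0 := by positivity
      linarith
    · rw [norm_zero]
      positivity
  · rw [logDerivCoeff_odd, Complex.norm_real, Real.norm_eq_abs, abs_mul, abs_mul, abs_two,
      abs_of_nonneg (zetaEvenSubOne_nonneg j), pow_succ, pow_mul]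
    have h2 : ((1 : ℝ) / 2) ^ 2 = 1 / 4 := by norm_num
    rw [h2]
    calc 2 * |ν| * zetaEvenSubOne j ≤ 2 * |ν| * (zetaEvenSubOne 0 * (1 / 4) ^ j) := by
          gcongr
          exact zetaEvenSubOne_le j
      _ = (0 + 4 * |ν| * zetaEvenSubOne 0) * ((1 / 4) ^ j * (1 / 2)) := by ring
      _ ≤ _ := by
          gcongr
          positivity

theorem hasSum_logDerivCoeff (x ν : ℝ) :
    HasSum (fun n : ℕ => logDerivCoeff x ν n / ((n : ℂ) + 1))
      (2 * Real.pi * x * Complex.I + ν * Real.log 2) := by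
  refine HasSum.even_add_odd ?_ ?_
  · have h := hasSum_ite_eq 0 (2 * Real.pi * x * Complex.I : ℂ)
    refine h.congr_fun fun j => ?_
    rw [logDerivCoeff_even]
    split_ifs with hj
    · simp [hj]
    · simp
  · have h := (Complex.hasSum_ofReal.2 hasSum_zetaEvenSubOne_div).mul_left (ν : ℂ)
    refine h.congr_fun fun j => ?_
    rw [logDerivCoeff_odd]
    have hj : (j : ℂ) + 1 ≠ 0 := by exact_mod_cast Nat.succ_ne_zero j
    have hj' : (((2 * j + 1 : ℕ) : ℂ) + 1) = 2 * (j + 1) := by push_cast; ring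
    rw [hj']
    push_cast
    field_simp

/-- The coefficients of the regular factor decay geometrically, uniformly for bounded `x`, and
its value at `u = i` is `2 ^ ν * exp (2 π i x)`. -/
theorem exists_regularFactor_bound (ν X₀ : ℝ) (hX : 0 ≤ X₀) :
    ∃ M : ℝ, ∀ x : ℝ, |x| ≤ X₀ →
      (∀ m, |coeff m (regularFactor x ν)| ≤ M * (3 / 4) ^ m) ∧
      HasSum (fun m => ((coeff m (regularFactor x ν) : ℝ) : ℂ) * Complex.I ^ m)
        (Complex.exp (2 * Real.pi * x * Complex.I + ν * Real.log 2)) := by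
  have hz := zetaEvenSubOne_nonneg 0
  have hπ := Real.pi_pos
  set K : ℝ := 2 * Real.pi * X₀ + 4 * |ν| * zetaEvenSubOne 0 with hK
  have hK0 : 0 ≤ K := by positivity
  obtain ⟨M, hM⟩ := exists_geometric_bound_of_recurrence hK0 (σ := 1 / 2) (ρ := 3 / 4)
    (by norm_num) (by norm_num)
  refine ⟨M, fun x hx => ?_⟩
  have hc := norm_logDerivCoeff_le ν hx
  have hp0 : ((coeff 0 (regularFactor x ν) : ℝ) : ℂ) * Complex.I ^ 0 = 1 := by
    rw [coeff_zero_regularFactor]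
    simp
  have hp := hM (fun m => ((coeff m (regularFactor x ν) : ℝ) : ℂ) * Complex.I ^ m) _ hp0
    (regularFactor_recurrence x ν) hc
  refine ⟨fun m => ?_, ?_⟩
  · have h := hp m
    rwa [norm_mul, norm_pow, Complex.norm_I, one_pow, mul_one, Complex.norm_real,
      Real.norm_eq_abs] at h
  · refine hasSum_exp_of_recurrence (by norm_num) (by norm_num) hp0
      (regularFactor_recurrence x ν) hp (K := K) (fun i => (hc i).trans ?_)
      (hasSum_logDerivCoeff x ν)
    exact mul_le_mul_of_nonneg_left (pow_le_pow_left₀ (by norm_num) (by norm_num) _) hK0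

end

/-! ### The asymptotic formula -/

section

open Finset Topology PowerSeries

theorem two_pi_pow_mul_coeff_genSeries (x ν : ℝ) (k : ℕ) :
    (2 * Real.pi) ^ k * coeff k (genSeries ℝ x ν) =
      ∑ m ∈ range (k + 1), coeff m (regularFactor x ν) * singCoeff ν (k - m) := by
  rw [← coeff_rescale, ← regularFactor_mul, coeff_mul,
    Finset.Nat.sum_antidiagonal_eq_sum_range_succ_mk]
  simp only [coeff_mk]

theorem summable_one_add_pow_mul_geometric {ρ : ℝ} (hρ0 : 0 < ρ) (hρ1 : ρ < 1) (B : ℕ) :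
    Summable fun m : ℕ => (1 + m : ℝ) ^ B * ρ ^ m := by
  have h := (summable_nat_add_iff 1).2 (summable_pow_mul_geometric_of_norm_lt_one (R := ℝ) B
    (by rwa [Real.norm_of_nonneg hρ0.le] : ‖ρ‖ < 1))
  refine (h.mul_right ρ⁻¹).congr fun m => ?_
  rw [pow_succ]
  push_cast
  field_simp
  ring

/-- The real part of `G(i) * exp (-i π k / 2)`, where `G` is the regular factor. -/
theorem hasSum_coeff_regularFactor_mul_cos {x ν : ℝ} (k : ℕ)
    (h : HasSum (fun m => ((coeff m (regularFactor x ν) : ℝ) : ℂ) * Complex.I ^ m)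
      (Complex.exp (2 * Real.pi * x * Complex.I + ν * Real.log 2))) :
    HasSum (fun m : ℕ => coeff m (regularFactor x ν) * Real.cos (Real.pi / 2 * ((k : ℝ) - m)))
      (2 ^ ν * Real.cos (2 * Real.pi * x - Real.pi / 2 * k)) := by
  have h1 := Complex.hasSum_re
    (h.mul_right (Complex.exp (((-(Real.pi / 2 * k) : ℝ) : ℂ) * Complex.I)))
  have hval : (Complex.exp (2 * Real.pi * x * Complex.I + ν * Real.log 2) *
      Complex.exp (((-(Real.pi / 2 * k) : ℝ) : ℂ) * Complex.I)).re =
      2 ^ ν * Real.cos (2 * Real.pi * x - Real.pi / 2 * k) := by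
    rw [← Complex.exp_add, show (2 * Real.pi * x * Complex.I + ν * Real.log 2 +
      ((-(Real.pi / 2 * k) : ℝ) : ℂ) * Complex.I : ℂ) = ((Real.log 2 * ν : ℝ) : ℂ) +
        ((2 * Real.pi * x - Real.pi / 2 * k : ℝ) : ℂ) * Complex.I by push_cast; ring,
      Complex.exp_add, ← Complex.ofReal_exp, Complex.re_ofReal_mul, Complex.exp_ofReal_mul_I_re,
      Real.rpow_def_of_pos two_pos]
  rw [hval] at h1
  refine h1.congr_fun fun m => ?_
  have hI : Complex.I ^ m = Complex.exp (((Real.pi / 2 * m : ℝ) : ℂ) * Complex.I) := by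
    conv_lhs => rw [← Complex.exp_pi_div_two_mul_I, ← Complex.exp_nat_mul]
    push_cast
    ring_nf
  rw [hI, mul_assoc, ← Complex.exp_add, ← add_mul, ← Complex.ofReal_add, Complex.re_ofReal_mul,
    Complex.exp_ofReal_mul_I_re, ← Real.cos_neg]
  ring_nf

/-- The asymptotic formula with an error of the true order `1 / k`. -/
theorem exists_A_bound {ν : ℝ} (hν : ∀ m : ℕ, ν ≠ -(m : ℝ)) (X₀ : ℝ) (hX : 0 ≤ X₀) :
    ∃ C : ℝ, 0 ≤ C ∧ ∀ k : ℕ, 1 ≤ k → ∀ x : ℝ, |x| ≤ X₀ →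
      |A k x ν *
          ((2 * Real.pi) ^ k * Real.Gamma ν / (2 * (k.factorial : ℝ) * (k : ℝ) ^ (ν - 1))) -
        Real.cos (2 * Real.pi * x - Real.pi / 2 * k)| ≤ C / k := by
  obtain ⟨C, B, hC, hterm⟩ := exists_normalized_singCoeff_bound hν
  obtain ⟨M, hM⟩ := exists_regularFactor_bound ν X₀ hX
  have hM0 : 0 ≤ M := by
    simpa using (abs_nonneg _).trans ((hM 0 (by simpa using hX)).1 0)
  have hsum := summable_one_add_pow_mul_geometric (ρ := 3 / 4) (by norm_num) (by norm_num) B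
  set S : ℝ := ∑' m : ℕ, (1 + m : ℝ) ^ B * (3 / 4) ^ m with hS
  have hS0 : 0 ≤ S := tsum_nonneg fun m => by positivity
  refine ⟨2 ^ (-ν) * (M * C * S), by positivity, fun k hk x hx => ?_⟩
  obtain ⟨hg, hcos⟩ := hM x hx
  have hk0 : (0 : ℝ) < k := by exact_mod_cast hk
  set g : ℕ → ℝ := fun m => coeff m (regularFactor x ν) with hgdef
  set t : ℕ → ℝ := fun m =>
    if m ≤ k then singCoeff ν (k - m) * Real.Gamma ν * ((k : ℝ) / 2) ^ (1 - ν) else 0 with ht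
  have hmain : A k x ν *
      ((2 * Real.pi) ^ k * Real.Gamma ν / (2 * (k.factorial : ℝ) * (k : ℝ) ^ (ν - 1))) =
      2 ^ (-ν) * ∑ m ∈ range (k + 1), g m * t m := by
    have h1 : ∑ m ∈ range (k + 1), g m * t m =
        (∑ m ∈ range (k + 1), g m * singCoeff ν (k - m)) *
          (Real.Gamma ν * ((k : ℝ) / 2) ^ (1 - ν)) := by
      rw [sum_mul]
      refine sum_congr rfl fun m hm => ?_
      have hmk : m ≤ k := Nat.lt_succ_iff.1 (mem_range.1 hm)
      simp only [ht, if_pos hmk]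
      ring
    have h2 : (2 : ℝ) ^ (-ν) * ((k : ℝ) / 2) ^ (1 - ν) = 1 / (2 * (k : ℝ) ^ (ν - 1)) := by
      have h3 : (0 : ℝ) < (k : ℝ) ^ (ν - 1) := Real.rpow_pos_of_pos hk0 _
      have h4 : (0 : ℝ) < 2 ^ ν := Real.rpow_pos_of_pos two_pos _
      rw [Real.div_rpow hk0.le two_pos.le, show 1 - ν = -(ν - 1) by ring, Real.rpow_neg hk0.le,
        Real.rpow_neg two_pos.le (ν - 1), Real.rpow_neg two_pos.le ν, Real.rpow_sub two_pos,
        Real.rpow_one]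
      field_simp
    have hf : (k.factorial : ℝ) ≠ 0 := by positivity
    rw [h1, hgdef, ← two_pi_pow_mul_coeff_genSeries, A_eq]
    calc _ = ((2 * Real.pi) ^ k * coeff k (genSeries ℝ x ν)) * Real.Gamma ν *
          (1 / (2 * (k : ℝ) ^ (ν - 1))) := by field_simp
      _ = _ := by rw [← h2]; ring
  have hcos' := hasSum_coeff_regularFactor_mul_cos k hcos
  have hfin : HasSum (fun m => g m * t m) (∑ m ∈ range (k + 1), g m * t m) := by
    refine hasSum_sum_of_ne_finset_zero fun m hm => ?_
    have hmk : ¬ m ≤ k := fun h => hm (mem_range.2 (Nat.lt_succ_of_le h))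
    simp only [ht, if_neg hmk, mul_zero]
  have hdiff := hfin.sub hcos'
  have hbound (m : ℕ) : ‖g m * t m - g m * Real.cos (Real.pi / 2 * ((k : ℝ) - m))‖ ≤
      M * C / k * ((1 + m : ℝ) ^ B * (3 / 4) ^ m) := by
    rw [← mul_sub, norm_mul, Real.norm_eq_abs, Real.norm_eq_abs]
    calc _ ≤ M * (3 / 4) ^ m * (C * (1 + m : ℝ) ^ B / k) :=
          mul_le_mul (hg m) (hterm k hk m) (abs_nonneg _) (by positivity)
      _ = _ := by ring
  have hle := tsum_of_norm_bounded (hsum.hasSum.mul_left (M * C / k)) hbound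
  rw [hdiff.tsum_eq, Real.norm_eq_abs] at hle
  have hone : (2 : ℝ) ^ (-ν) * 2 ^ ν = 1 := by
    rw [← Real.rpow_add two_pos, neg_add_cancel, Real.rpow_zero]
  have hsplit (s c : ℝ) : 2 ^ (-ν) * s - c = 2 ^ (-ν) * (s - 2 ^ ν * c) := by
    linear_combination c * hone
  rw [hmain, hsplit, abs_mul, abs_of_pos (Real.rpow_pos_of_pos two_pos (-ν))]
  calc _ ≤ (2 : ℝ) ^ (-ν) * (M * C / k * S) := by gcongr
    _ = _ := by ring

end

end GenBernoulli

theorem theorem3p2 (ν : ℝ) (hν : ∀ m : ℕ, ν ≠ -(m : ℝ)) (a b : ℝ) :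
    TendstoUniformlyOn
      (fun (k : ℕ) (x : ℝ) =>
        (-1 : ℝ) ^ k * GenBernoulli.A (2 * k) x ν *
          ((2 * Real.pi) ^ (2 * k) * Real.Gamma ν /
            (2 * ((2 * k).factorial : ℝ) * ((2 * k : ℕ) : ℝ) ^ (ν - 1))))
      (fun x => Real.cos (2 * Real.pi * x)) atTop (Set.Icc a b) ∧
    TendstoUniformlyOn
      (fun (k : ℕ) (x : ℝ) =>
        (-1 : ℝ) ^ (k - 1) * GenBernoulli.A (2 * k - 1) x ν *
          ((2 * Real.pi) ^ (2 * k - 1) * Real.Gamma ν /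
            (2 * ((2 * k - 1).factorial : ℝ) * ((2 * k - 1 : ℕ) : ℝ) ^ (ν - 1))))
      (fun x => Real.sin (2 * Real.pi * x)) atTop (Set.Icc a b) ∧
    ∃ C : ℝ, 0 < C ∧ ∀ k : ℕ, 1 ≤ k → ∀ x ∈ Set.Icc a b,
      |GenBernoulli.A k x ν *
          ((2 * Real.pi) ^ k * Real.Gamma ν / (2 * (k.factorial : ℝ) * (k : ℝ) ^ (ν - 1))) -
        Real.cos (2 * Real.pi * x - Real.pi / 2 * k)| < C * (k : ℝ) ^ (-(7 / 9) : ℝ) := by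
  obtain ⟨C, hC, hbound⟩ := GenBernoulli.exists_A_bound hν (max |a| |b|)
    ((abs_nonneg a).trans (le_max_left _ _))
  have habs {x : ℝ} (hx : x ∈ Set.Icc a b) : |x| ≤ max |a| |b| :=
    abs_le_max_abs_abs hx.1 hx.2
  have hlim : Tendsto (fun n : ℕ => C / (n : ℝ)) atTop (nhds 0) :=
    tendsto_const_div_atTop_nhds_zero_nat C
  -- Along a subsequence `φ` the estimate gives uniform convergence of the signed functions.
  have hunif (φ : ℕ → ℕ) (hφ : Tendsto φ atTop atTop) (sgn : ℕ → ℝ) (hs : ∀ k, |sgn k| = 1)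
      (f : ℝ → ℝ) (hf : ∀ k : ℕ, 1 ≤ k → ∀ x : ℝ,
        f x = sgn k * Real.cos (2 * Real.pi * x - Real.pi / 2 * (φ k : ℝ))) :
      TendstoUniformlyOn
        (fun (k : ℕ) (x : ℝ) => sgn k * GenBernoulli.A (φ k) x ν *
          ((2 * Real.pi) ^ (φ k) * Real.Gamma ν /
            (2 * ((φ k).factorial : ℝ) * (φ k : ℝ) ^ (ν - 1)))) f atTop (Set.Icc a b) := by
    rw [Metric.tendstoUniformlyOn_iff]
    intro ε hε
    filter_upwards [(hlim.comp hφ).eventually_lt_const hε, hφ.eventually_ge_atTop 1,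
      eventually_ge_atTop 1] with k hk hk1 hk2 x hx
    rw [dist_comm, Real.dist_eq, hf k hk2, mul_assoc, ← mul_sub, abs_mul, hs, one_mul]
    exact (hbound _ hk1 x (habs hx)).trans_lt hk
  refine ⟨?_, ?_, C + 1, by positivity, fun k hk x hx => ?_⟩
  · refine hunif (fun k => 2 * k) (tendsto_id.const_mul_atTop' two_pos) (fun k => (-1) ^ k)
      (fun k => by simp) _ fun k _ x => ?_
    rw [show Real.pi / 2 * ((2 * k : ℕ) : ℝ) = k * Real.pi by push_cast; ring,
      Real.cos_sub_nat_mul_pi, ← mul_assoc, ← mul_pow]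
    simp
  · refine hunif (fun k => 2 * k - 1)
      (tendsto_atTop_mono (fun k => by omega : ∀ k : ℕ, k - 1 ≤ 2 * k - 1)
        (tendsto_sub_atTop_nat 1)) (fun k => (-1) ^ (k - 1))
      (fun k => by simp) _ fun k hk x => ?_
    obtain ⟨j, rfl⟩ := Nat.exists_eq_add_of_le' hk
    have h2 : 2 * (j + 1) - 1 = 2 * j + 1 := by omega
    rw [h2, Nat.add_sub_cancel, show 2 * Real.pi * x - Real.pi / 2 * ((2 * j + 1 : ℕ) : ℝ) =
      (2 * Real.pi * x - Real.pi / 2) - j * Real.pi by push_cast; ring,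
      Real.cos_sub_nat_mul_pi, Real.cos_sub_pi_div_two, ← mul_assoc, ← mul_pow]
    simp
  · have hk0 : (0 : ℝ) < k := by exact_mod_cast hk
    have hk1 : (1 : ℝ) ≤ k := by exact_mod_cast hk
    have hpow : (k : ℝ) ^ (-1 : ℝ) ≤ (k : ℝ) ^ (-(7 / 9) : ℝ) :=
      Real.rpow_le_rpow_of_exponent_le hk1 (by norm_num)
    have hpos : 0 < (k : ℝ) ^ (-(7 / 9) : ℝ) := Real.rpow_pos_of_pos hk0 _
    rw [Real.rpow_neg_one] at hpow
    calc _ ≤ C / k := hbound k hk x (habs hx)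
      _ = C * (k : ℝ)⁻¹ := div_eq_mul_inv _ _
      _ ≤ C * (k : ℝ) ^ (-(7 / 9) : ℝ) := by gcongr
      _ < (C + 1) * (k : ℝ) ^ (-(7 / 9) : ℝ) := by gcongr; linarith
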